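/- Let $\mathcal F$ be a hereditary family of finite subsets of $\mathbb N$ with $\bigcup\mathcal F=\mathbb N$ (hereditary: $E'\subseteq E\in\mathcal F$ implies $E'\in\mathcal F$). For $x\in\mathbb R^{\mathbb N}$ put \[ \|x\|_{\mathcal F}=\sup\Big\{\sum_{k\in E}|x(k)| : E\in\mathcal F\Big\}\in[0,\infty], \] and let \[ X_{\mathcal F}=\big\{x\in\mathbb R^{\mathbb N} : \|P_{[n,\infty)}(x)\|_{\mathcal F}\to 0 \text{ as } n\to\infty\big\}, \] a Banach space with the norm $\|\cdot\|_{\mathcal F}$, where $P_{[n,\infty)}$ is the coordinate projection onto $[n,\infty)$. Let $e_n\in X_{\mathcal F}$ be the $n$-th unit vector. For $H\subseteq\mathbb N$ let $X_{\mathcal F\upharpoonright H}=\overline{\mathrm{span}}\{e_n : n\in H\}\subseteq X_{\mathcal F}$, and let \[ \mathcal H(\mathcal F,\neg c_0)=\big\{H\subseteq\mathbb N : X_{\mathcal F\upharpoonright H}\text{ does not contain a subspace isomorphic to } c_0\big\}. \] Identify the power set $\mathcal P(\mathbb N)$ with $2^{\mathbb N}$ through characteristic functions, equipped with the product topology and the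 product of the fair-coin measures. Then the following are equivalent: (i) $X_{\mathcal F}$ does not contain a subspace isomorphic to $c_0$; (ii) $\mathcal H(\mathcal F,\neg c_0)=\mathcal P(\mathbb N)$; (iii) $\mathcal H(\mathcal F,\neg c_0)$ is not null in $2^{\mathbb N}$; (iv) $\mathcal H(\mathcal F,\neg c_0)$ is not meager in $2^{\mathbb N}$. -/

import Mathlib

open Set Filter Topology MeasureTheory
open scoped ENNReal ZeroAtInfty

/-- Hereditary covers of `ℕ` by finite sets: families of finite sets that are closed under
taking subsets and whose union is `ℕ`. -/
structure FHC where
  family : Set (Finset ℕ)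
  hereditary : ∀ E ∈ family, ∀ E' : Finset ℕ, E' ⊆ E → E' ∈ family
  covers : ∀ n : ℕ, ∃ E ∈ family, n ∈ E

namespace FHC

/-- The extended norm `‖x‖_F = sup {∑ k ∈ E, |x k| : E ∈ F}` on `ℝ^ℕ`, with values in `[0, ∞]`. -/
noncomputable def extNorm (F : FHC) (x : ℕ → ℝ) : ℝ≥0∞ :=
  ⨆ E ∈ F.family, ∑ k ∈ E, ENNReal.ofReal |x k|

theorem extNorm_add_le (F : FHC) (x y : ℕ → ℝ) :
    F.extNorm (x + y) ≤ F.extNorm x + F.extNorm y := by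
  refine iSup₂_le fun E hE => ?_
  calc ∑ k ∈ E, ENNReal.ofReal |(x + y) k|
      ≤ ∑ k ∈ E, (ENNReal.ofReal |x k| + ENNReal.ofReal |y k|) := by
        refine Finset.sum_le_sum fun k _ => ?_
        rw [← ENNReal.ofReal_add (abs_nonneg _) (abs_nonneg _)]
        exact ENNReal.ofReal_le_ofReal (abs_add_le _ _)
    _ = ∑ k ∈ E, ENNReal.ofReal |x k| + ∑ k ∈ E, ENNReal.ofReal |y k| :=
        Finset.sum_add_distrib
    _ ≤ F.extNorm x + F.extNorm y :=
        add_le_add (le_iSup₂ (f := fun E (_ : E ∈ F.family) => ∑ k ∈ E, ENNReal.ofReal |x k|) E hE)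
          (le_iSup₂ (f := fun E (_ : E ∈ F.family) => ∑ k ∈ E, ENNReal.ofReal |y k|) E hE)

theorem extNorm_smul (F : FHC) (c : ℝ) (x : ℕ → ℝ) :
    F.extNorm (c • x) = ENNReal.ofReal |c| * F.extNorm x := by
  simp only [extNorm, ENNReal.mul_iSup, Finset.mul_sum, Pi.smul_apply, smul_eq_mul, abs_mul,
    ENNReal.ofReal_mul (abs_nonneg c)]

theorem extNorm_zero (F : FHC) : F.extNorm 0 = 0 := by
  simp [extNorm]

theorem le_extNorm (F : FHC) (x : ℕ → ℝ) (n : ℕ) : ENNReal.ofReal |x n| ≤ F.extNorm x := by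
  obtain ⟨E, hE, hn⟩ := F.covers n
  exact (Finset.single_le_sum (f := fun k => ENNReal.ofReal |x k|) (fun _ _ => zero_le) hn).trans
    (le_iSup₂ (f := fun E (_ : E ∈ F.family) => ∑ k ∈ E, ENNReal.ofReal |x k|) E hE)

/-- `EXH(F)`: the sequences `x` such that `‖P_{[n,∞)} x‖_F → 0`, where the coordinate projection
`P_{[n,∞)} x` is `(Ici n).indicator x`. -/
noncomputable def exh (F : FHC) : Submodule ℝ (ℕ → ℝ) where
  carrier := {x | Tendsto (fun n : ℕ => F.extNorm ((Ici n).indicator x)) atTop (𝓝 0)}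
  zero_mem' := by simp [extNorm_zero]
  add_mem' := by
    intro x y hx hy
    have h := Tendsto.add hx hy
    rw [add_zero] at h
    refine tendsto_of_tendsto_of_tendsto_of_le_of_le tendsto_const_nhds h
      (fun _ => zero_le) fun n => ?_
    have e : (Ici n).indicator (x + y) = (Ici n).indicator x + (Ici n).indicator y :=
      Set.indicator_add' _ _ _
    simp only [e]
    exact F.extNorm_add_le _ _
  smul_mem' := by
    intro c x hx
    have h := ENNReal.Tendsto.const_mul (a := ENNReal.ofReal |c|) hx
      (Or.inr ENNReal.ofReal_ne_top)
    rw [mul_zero] at h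
    refine h.congr fun n => ?_
    have e : (Ici n).indicator (c • x) = c • (Ici n).indicator x :=
      Set.indicator_const_smul (Ici n) c x
    rw [e, extNorm_smul]

theorem extNorm_ne_top (F : FHC) {x : ℕ → ℝ} (hx : x ∈ F.exh) : F.extNorm x ≠ ∞ := by
  have hx' : Tendsto (fun n : ℕ => F.extNorm ((Ici n).indicator x)) atTop (𝓝 0) := hx
  obtain ⟨n, hn⟩ := (hx'.eventually (gt_mem_nhds ENNReal.zero_lt_top)).exists
  have hx2 : x = (Iio n).indicator x + (Ici n).indicator x := by
    rw [← Set.compl_Iio]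
    exact (Set.indicator_self_add_compl _ _).symm
  have h1 : F.extNorm ((Iio n).indicator x) ≤ ∑ k ∈ Finset.range n, ENNReal.ofReal |x k| := by
    refine iSup₂_le fun E _ => ?_
    calc ∑ k ∈ E, ENNReal.ofReal |(Iio n).indicator x k|
        = ∑ k ∈ E, if k ∈ Finset.range n then ENNReal.ofReal |x k| else 0 := by
          refine Finset.sum_congr rfl fun k _ => ?_
          by_cases hk : k < n <;> simp [Set.indicator, hk]
      _ = ∑ k ∈ E with k ∈ Finset.range n, ENNReal.ofReal |x k| := by rw [Finset.sum_filter]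
      _ ≤ ∑ k ∈ Finset.range n, ENNReal.ofReal |x k| :=
          Finset.sum_le_sum_of_subset fun k hk => (Finset.mem_filter.1 hk).2
  have h2 : ∑ k ∈ Finset.range n, ENNReal.ofReal |x k| ≠ ∞ :=
    ENNReal.sum_ne_top.2 fun _ _ => ENNReal.ofReal_ne_top
  have h3 := F.extNorm_add_le ((Iio n).indicator x) ((Ici n).indicator x)
  rw [← hx2] at h3
  exact ne_top_of_le_ne_top (ENNReal.add_ne_top.2 ⟨ne_top_of_le_ne_top h2 h1, hn.ne⟩) h3

/-- The combinatorial space `X_F`: the vector space `EXH(F)` with the norm `‖·‖_F`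
(and not with the topology of pointwise convergence). -/
def X (F : FHC) : Type := F.exh

noncomputable instance (F : FHC) : AddCommGroup F.X := inferInstanceAs (AddCommGroup F.exh)

noncomputable instance (F : FHC) : Module ℝ F.X := inferInstanceAs (Module ℝ F.exh)

/-- The underlying sequence of an element of `X_F`. -/
def X.toSeq {F : FHC} (x : F.X) : ℕ → ℝ := Subtype.val x

noncomputable instance (F : FHC) : Norm F.X := ⟨fun x => (F.extNorm x.toSeq).toReal⟩

theorem X.norm_def {F : FHC} (x : F.X) : ‖x‖ = (F.extNorm x.toSeq).toReal := rfl

theorem X.core (F : FHC) : NormedSpace.Core ℝ F.X where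
  norm_nonneg _ := ENNReal.toReal_nonneg
  norm_smul c x := by
    change (F.extNorm (c • x.toSeq)).toReal = ‖c‖ * (F.extNorm x.toSeq).toReal
    rw [extNorm_smul, ENNReal.toReal_mul, ENNReal.toReal_ofReal (abs_nonneg c), Real.norm_eq_abs]
  norm_triangle x y := by
    change (F.extNorm (x.toSeq + y.toSeq)).toReal
      ≤ (F.extNorm x.toSeq).toReal + (F.extNorm y.toSeq).toReal
    have hx : F.extNorm x.toSeq ≠ ∞ := F.extNorm_ne_top x.2
    have hy : F.extNorm y.toSeq ≠ ∞ := F.extNorm_ne_top y.2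
    rw [← ENNReal.toReal_add hx hy]
    exact ENNReal.toReal_mono (ENNReal.add_ne_top.2 ⟨hx, hy⟩) (F.extNorm_add_le _ _)
  norm_eq_zero_iff x := by
    constructor
    · intro h
      have h0 : F.extNorm x.toSeq = 0 :=
        ((ENNReal.toReal_eq_zero_iff _).1 h).resolve_right (F.extNorm_ne_top x.2)
      refine Subtype.ext (funext fun n => ?_)
      have h1 := F.le_extNorm x.toSeq n
      rw [h0, nonpos_iff_eq_zero, ENNReal.ofReal_eq_zero] at h1
      exact abs_nonpos_iff.1 h1
    · rintro rfl
      change (F.extNorm 0).toReal = 0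
      rw [extNorm_zero, ENNReal.toReal_zero]

noncomputable instance (F : FHC) : NormedAddCommGroup F.X := NormedAddCommGroup.ofCore (X.core F)

noncomputable instance (F : FHC) : NormedSpace ℝ F.X := NormedSpace.ofCore (X.core F)

theorem single_mem_exh (F : FHC) (n : ℕ) : (Pi.single n 1 : ℕ → ℝ) ∈ F.exh := by
  refine tendsto_const_nhds.congr' ?_
  filter_upwards [eventually_gt_atTop n] with m hm
  have e : (Ici m).indicator (Pi.single n 1 : ℕ → ℝ) = 0 := by
    ext k
    by_cases hk : m ≤ k
    · simp [Set.indicator, hk, (hm.trans_le hk).ne']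
    · simp [Set.indicator, hk]
  rw [e, extNorm_zero]

/-- The canonical unit vector `e_n` of `X_F`. -/
noncomputable def e (F : FHC) (n : ℕ) : F.X := ⟨Pi.single n 1, F.single_mem_exh n⟩

/-- `X_{F ↾ H}`: the closed linear span of `{e_n : n ∈ H}` in `X_F`. -/
noncomputable def XRestrict (F : FHC) (H : Set ℕ) : Submodule ℝ F.X :=
  (Submodule.span ℝ (F.e '' H)).topologicalClosure

end FHC

/-- The normed space `V` contains a copy of `c₀`: some linear subspace of `V` is linearly
homeomorphic to `c₀ = C₀(ℕ, ℝ)`, the space of real null sequences with the sup norm. (Such a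
subspace is complete, hence closed.) -/
def ContainsC0 (V : Type*) [NormedAddCommGroup V] [NormedSpace ℝ V] : Prop :=
  ∃ Y : Submodule ℝ V, Nonempty (C₀(ℕ, ℝ) ≃L[ℝ] Y)

/-- The family `H(F, ¬c₀)` of all `H ⊆ ℕ` such that `X_{F ↾ H}` does not contain `c₀`. -/
def FHC.notC0 (F : FHC) : Set (Set ℕ) :=
  {H | ¬ ContainsC0 (F.XRestrict H)}

/-- A family of subsets of `ℕ`, seen as a subset of the Cantor space `2^ℕ` through
characteristic functions. -/
def toCantor (A : Set (Set ℕ)) : Set (ℕ → Bool) :=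
  {χ | {n | χ n = true} ∈ A}

/-- The usual product probability measure on `2^ℕ`: independent fair coins. -/
noncomputable def cantorMeasure : Measure (ℕ → Bool) :=
  Measure.infinitePi fun _ : ℕ => (PMF.uniformOfFintype Bool).toMeasure

theorem exists_strictMono_blocks {P : ℕ → ℕ → ℕ → Prop} (h : ∀ i n, ∃ m, n < m ∧ P i n m) :
    ∃ (u b : ℕ → ℕ), StrictMono u ∧ (∀ i, P i (u i) (u (i + 1))) ∧
      ∀ k i, b k = i ↔ u i ≤ k ∧ k < u (i + 1) := by
  choose g hg hP using h
  let u : ℕ → ℕ := fun i => Nat.rec 0 (fun i n => g i n) i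
  have hu : StrictMono u := strictMono_nat_of_lt_succ fun i => hg i (u i)
  have hex : ∀ k, ∃ i, k < u (i + 1) := fun k =>
    ⟨k, (Nat.lt_succ_self k).trans_le (hu.id_le (k + 1))⟩
  classical
  refine ⟨u, fun k => Nat.find (hex k), hu, fun i => hP i (u i), fun k i => ?_⟩
  rw [Nat.find_eq_iff, and_comm]
  refine and_congr_left fun _ => ⟨fun h => ?_, fun h j hj => ?_⟩
  · rcases i with _ | i
    · exact Nat.zero_le _
    · exact not_lt.1 (h i (Nat.lt_succ_self i))
  · exact not_lt.2 ((hu.monotone (Nat.succ_le_of_lt hj)).trans h)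

/-! ### Embeddings of `c₀` -/

theorem containsC0_of_bounds {V : Type*} [NormedAddCommGroup V] [NormedSpace ℝ V]
    (T : C₀(ℕ, ℝ) →ₗ[ℝ] V) {c C : ℝ} (hc : 0 < c) (hT : ∀ a, ‖T a‖ ≤ C * ‖a‖)
    (hT' : ∀ a, c * ‖a‖ ≤ ‖T a‖) : ContainsC0 V := by
  have hinj : Function.Injective T := by
    rw [← LinearMap.ker_eq_bot, LinearMap.ker_eq_bot']
    intro a ha
    have := hT' a
    rw [ha, norm_zero] at this
    exact norm_le_zero_iff.1 (nonpos_of_mul_nonpos_right this hc)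
  refine ⟨LinearMap.range T, ⟨(LinearEquiv.ofInjective T hinj).toContinuousLinearEquivOfBounds
    C c⁻¹ hT fun y => ?_⟩⟩
  obtain ⟨a, rfl⟩ := (LinearEquiv.ofInjective T hinj).surjective y
  rw [LinearEquiv.symm_apply_apply, inv_mul_eq_div, le_div_iff₀ hc, mul_comm]
  exact hT' a

theorem ContainsC0.exists_bounds {V : Type*} [NormedAddCommGroup V] [NormedSpace ℝ V]
    (h : ContainsC0 V) : ∃ (T : C₀(ℕ, ℝ) →ₗ[ℝ] V) (c C : ℝ), 0 < c ∧
      (∀ a, ‖T a‖ ≤ C * ‖a‖) ∧ ∀ a, c * ‖a‖ ≤ ‖T a‖ := by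
  obtain ⟨Y, ⟨S⟩⟩ := h
  obtain ⟨K, hK, hS⟩ := (S.symm : Y →L[ℝ] C₀(ℕ, ℝ)).bound
  refine ⟨Y.subtype ∘ₗ S.toLinearEquiv.toLinearMap, K⁻¹, ‖(S : C₀(ℕ, ℝ) →L[ℝ] Y)‖,
    inv_pos.2 hK, fun a => (S : C₀(ℕ, ℝ) →L[ℝ] Y).le_opNorm a, fun a => ?_⟩
  rw [inv_mul_le_iff₀ hK]
  simpa using hS (S a)

theorem ContainsC0.of_submodule {V : Type*} [NormedAddCommGroup V] [NormedSpace ℝ V]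
    {W : Submodule ℝ V} (h : ContainsC0 W) : ContainsC0 V := by
  obtain ⟨T, c, C, hc, h1, h2⟩ := h.exists_bounds
  exact containsC0_of_bounds (W.subtype ∘ₗ T) hc h1 h2

theorem norm_c0_le_iff {a : C₀(ℕ, ℝ)} {M : ℝ} (hM : 0 ≤ M) : ‖a‖ ≤ M ↔ ∀ i, |a i| ≤ M := by
  rw [← ZeroAtInftyContinuousMap.norm_toBCF_eq_norm, BoundedContinuousFunction.norm_le hM]
  rfl

theorem abs_apply_le_norm_c0 (a : C₀(ℕ, ℝ)) (i : ℕ) : |a i| ≤ ‖a‖ :=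
  (norm_c0_le_iff (norm_nonneg a)).1 le_rfl i

/-- The unit vectors of `c₀`. -/
noncomputable def c0Single (j : ℕ) : C₀(ℕ, ℝ) where
  toFun := Pi.single j 1
  continuous_toFun := continuous_of_discreteTopology
  zero_at_infty' := by
    rw [cocompact_eq_cofinite, Nat.cofinite_eq_atTop]
    refine tendsto_const_nhds.congr' ?_
    filter_upwards [eventually_gt_atTop j] with m hm
    rw [Pi.single_eq_of_ne hm.ne']

theorem c0Single_apply (j i : ℕ) : c0Single j i = (Pi.single j 1 : ℕ → ℝ) i := rfl

theorem one_le_norm_c0Single (j : ℕ) : 1 ≤ ‖c0Single j‖ := by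
  simpa [c0Single_apply] using abs_apply_le_norm_c0 (c0Single j) j

theorem norm_sum_smul_c0Single_le (s : Finset ℕ) (σ : ℕ → ℝ) (hσ : ∀ j, |σ j| ≤ 1) :
    ‖∑ j ∈ s, σ j • c0Single j‖ ≤ 1 := by
  rw [norm_c0_le_iff zero_le_one]
  intro i
  have : (∑ j ∈ s, σ j • c0Single j) i = if i ∈ s then σ i else 0 := by
    have h : ∀ t : Finset ℕ, (∑ j ∈ t, σ j • c0Single j) i = ∑ j ∈ t, σ j * c0Single j i := by
      intro t
      induction t using Finset.cons_induction with
      | empty => simp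
      | cons j t hj ih => rw [Finset.sum_cons, Finset.sum_cons, ← ih]; rfl
    simp [h, c0Single_apply, Pi.single_apply]
  rw [this]
  split_ifs
  · exact hσ i
  · simp

namespace FHC

/-! ### The norm of `X_F` -/

theorem extNorm_le_iff (F : FHC) (x : ℕ → ℝ) {M : ℝ} (hM : 0 ≤ M) :
    F.extNorm x ≤ ENNReal.ofReal M ↔ ∀ E ∈ F.family, ∑ k ∈ E, |x k| ≤ M := by
  simp only [extNorm, iSup_le_iff]
  refine forall₂_congr fun E _ => ?_
  rw [← ENNReal.ofReal_sum_of_nonneg fun k _ => abs_nonneg _, ENNReal.ofReal_le_ofReal_iff hM]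

theorem extNorm_mono (F : FHC) {x y : ℕ → ℝ} (h : ∀ k, |x k| ≤ |y k|) :
    F.extNorm x ≤ F.extNorm y :=
  iSup₂_mono fun _ _ => Finset.sum_le_sum fun k _ => ENNReal.ofReal_le_ofReal (h k)

theorem X.norm_le_iff {F : FHC} (x : F.X) {M : ℝ} (hM : 0 ≤ M) :
    ‖x‖ ≤ M ↔ ∀ E ∈ F.family, ∑ k ∈ E, |x.toSeq k| ≤ M := by
  rw [← extNorm_le_iff F _ hM, X.norm_def]
  exact (ENNReal.le_ofReal_iff_toReal_le (F.extNorm_ne_top x.2) hM).symm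

theorem X.sum_abs_le_norm {F : FHC} (x : F.X) {E : Finset ℕ} (hE : E ∈ F.family) :
    ∑ k ∈ E, |x.toSeq k| ≤ ‖x‖ :=
  (X.norm_le_iff x (norm_nonneg x)).1 le_rfl E hE

theorem X.toSeq_sub {F : FHC} (x y : F.X) : (x - y).toSeq = x.toSeq - y.toSeq := rfl

theorem X.toSeq_smul {F : FHC} (c : ℝ) (x : F.X) : (c • x).toSeq = c • x.toSeq := rfl

theorem X.toSeq_sum {F : FHC} (s : Finset ℕ) (f : ℕ → F.X) (k : ℕ) :
    (∑ j ∈ s, f j).toSeq k = ∑ j ∈ s, (f j).toSeq k := by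
  induction s using Finset.cons_induction with
  | empty => rfl
  | cons j t hj ih => rw [Finset.sum_cons, Finset.sum_cons, ← ih]; rfl

theorem mem_XRestrict {F : FHC} {H : Set ℕ} (x : F.X) (hx : ∀ k, k ∉ H → x.toSeq k = 0) :
    x ∈ F.XRestrict H := by
  have hlim : Tendsto (fun n => ∑ k ∈ Finset.range n, x.toSeq k • F.e k) atTop (𝓝 x) := by
    rw [tendsto_iff_norm_sub_tendsto_zero]
    have h0 : Tendsto (fun n : ℕ => F.extNorm ((Ici n).indicator x.toSeq)) atTop (𝓝 0) := x.2
    have h1 := (ENNReal.tendsto_toReal ENNReal.zero_ne_top).comp h0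
    refine h1.congr fun n => ?_
    rw [← norm_neg, neg_sub, X.norm_def, X.toSeq_sub, Function.comp_apply]
    congr 2
    ext k
    rw [Pi.sub_apply, X.toSeq_sum]
    have : ∀ j, (x.toSeq j • F.e j).toSeq k = if k = j then x.toSeq j else 0 := fun j => by
      change x.toSeq j * (Pi.single j 1 : ℕ → ℝ) k = _
      simp [Pi.single_apply]
    simp only [this, Finset.sum_ite_eq, Finset.mem_range]
    by_cases hk : k < n
    · simp [Set.indicator, hk, not_le.2 hk]
    · simp [Set.indicator, hk, not_lt.1 hk]
  refine mem_closure_of_tendsto hlim (Eventually.of_forall fun n => ?_)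
  refine Submodule.sum_mem _ fun k _ => ?_
  by_cases hk : k ∈ H
  · exact Submodule.smul_mem _ _ (Submodule.subset_span ⟨k, hk, rfl⟩)
  · rw [hx k hk, zero_smul]
    exact Submodule.zero_mem _

/-- The sequence `y` has finite norm, and its tails carry sums over members of `F` that are bounded
away from zero. -/
def HasBumps (F : FHC) (y : ℕ → ℝ) : Prop :=
  F.extNorm y ≠ ∞ ∧ ∃ δ : ℝ, 0 < δ ∧
    ∀ n, ∃ D ∈ F.family, (∀ k ∈ D, n ≤ k) ∧ δ ≤ ∑ k ∈ D, |y k|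

theorem HasBumps.containsC0 {F : FHC} {y : ℕ → ℝ} (hy : F.HasBumps y) {H : Set ℕ}
    (hH : ∀ k, k ∉ H → y k = 0) : ContainsC0 (F.XRestrict H) := by
  obtain ⟨hfin, δ, hδ, hD⟩ := hy
  obtain ⟨u, b, hu, hP, hb⟩ := exists_strictMono_blocks
    (P := fun _ n m => ∃ D ∈ F.family, (∀ k ∈ D, n ≤ k ∧ k < m) ∧ δ ≤ ∑ k ∈ D, |y k|) fun _ n => by
      obtain ⟨D, hDF, hn, hs⟩ := hD n
      refine ⟨n + D.sup id + 1, by omega, D, hDF, fun k hk => ⟨hn k hk, ?_⟩, hs⟩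
      have : k ≤ D.sup id := Finset.le_sup (f := id) hk
      omega
  have hbu : ∀ N k, u N ≤ k → N ≤ b k := fun N k hk => by
    by_contra! h
    exact absurd (((hb k _).1 rfl).2.trans_le (hu.monotone (Nat.succ_le_of_lt h))) (not_lt.2 hk)
  have hexh : ∀ a : C₀(ℕ, ℝ), (fun k => a (b k) * y k) ∈ F.exh := fun a => by
    have ha : Tendsto a atTop (𝓝 0) := by
      rw [← Nat.cofinite_eq_atTop, ← cocompact_eq_cofinite]
      exact a.zero_at_infty'
    change Tendsto _ _ _
    rw [ENNReal.tendsto_nhds_zero]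
    intro ε hε
    obtain ⟨r, hr, hrε⟩ : ∃ r : ℝ, 0 < r ∧ ENNReal.ofReal r * F.extNorm y ≤ ε := by
      have h : Tendsto (fun r : ℝ => ENNReal.ofReal r * F.extNorm y) (𝓝[>] 0) (𝓝 0) := by
        have := ENNReal.Tendsto.mul_const (b := F.extNorm y)
          (ENNReal.tendsto_ofReal (tendsto_id (α := ℝ) (x := 𝓝 0))) (Or.inr hfin)
        rw [ENNReal.ofReal_zero, zero_mul] at this
        exact this.mono_left nhdsWithin_le_nhds
      obtain ⟨r, hr⟩ := ((ENNReal.tendsto_nhds_zero.1 h ε hε).and self_mem_nhdsWithin).exists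
      exact ⟨r, hr.2, hr.1⟩
    obtain ⟨N, hN⟩ := Metric.tendsto_atTop.1 ha r hr
    filter_upwards [eventually_ge_atTop (u N)] with n hn
    refine le_trans ?_ hrε
    rw [← abs_of_pos hr, ← extNorm_smul]
    refine F.extNorm_mono fun k => ?_
    by_cases hk : n ≤ k
    · have := hN (b k) (hbu N k (hn.trans hk))
      rw [dist_zero_right, Real.norm_eq_abs] at this
      simp only [Set.indicator, mem_Ici, hk, if_true, Pi.smul_apply, smul_eq_mul, abs_mul,
        abs_of_pos hr]
      gcongr
    · simp [Set.indicator, hk, mul_nonneg]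
  let x : C₀(ℕ, ℝ) → F.X := fun a => ⟨fun k => a (b k) * y k, hexh a⟩
  have hx : ∀ a k, (x a).toSeq k = a (b k) * y k := fun _ _ => rfl
  let T : C₀(ℕ, ℝ) →ₗ[ℝ] F.XRestrict H :=
    { toFun := fun a => ⟨x a, mem_XRestrict _ fun k hk => by rw [hx, hH k hk, mul_zero]⟩
      map_add' := fun a a' => Subtype.ext (Subtype.ext (funext fun k => add_mul _ _ _))
      map_smul' := fun c a => Subtype.ext (Subtype.ext (funext fun k => mul_assoc _ _ _)) }
  have hT : ∀ a, ‖T a‖ = ‖x a‖ := fun _ => rfl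
  refine containsC0_of_bounds T (C := (F.extNorm y).toReal) hδ (fun a => ?_) fun a => ?_
  · rw [hT, X.norm_def, mul_comm, ← abs_of_nonneg (norm_nonneg a),
      ← ENNReal.toReal_ofReal (abs_nonneg ‖a‖), ← ENNReal.toReal_mul, ← extNorm_smul]
    refine ENNReal.toReal_mono ?_ (F.extNorm_mono fun k => ?_)
    · rw [extNorm_smul]
      exact ENNReal.mul_ne_top ENNReal.ofReal_ne_top hfin
    · rw [hx, Pi.smul_apply, smul_eq_mul, abs_mul, abs_mul, abs_norm]
      gcongr
      exact abs_apply_le_norm_c0 a _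
  · rw [hT, mul_comm, ← le_div_iff₀ hδ, norm_c0_le_iff (by positivity)]
    intro i
    obtain ⟨D, hDF, hDu, hs⟩ := hP i
    rw [le_div_iff₀ hδ]
    calc |a i| * δ ≤ |a i| * ∑ k ∈ D, |y k| := by gcongr
      _ = ∑ k ∈ D, |(x a).toSeq k| := by
        rw [Finset.mul_sum]
        exact Finset.sum_congr rfl fun k hk => by rw [hx, (hb k i).2 (hDu k hk), abs_mul]
      _ ≤ ‖x a‖ := X.sum_abs_le_norm _ hDF

end FHC

namespace FHC

theorem tendsto_toSeq_of_norm_sum_smul_le {F : FHC} {f : ℕ → F.X} {C : ℝ}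
    (hC : ∀ (s : Finset ℕ) (σ : ℕ → ℝ), (∀ j, |σ j| ≤ 1) → ‖∑ j ∈ s, σ j • f j‖ ≤ C) (k : ℕ) :
    Tendsto (fun j => (f j).toSeq k) atTop (𝓝 0) := by
  obtain ⟨E, hE, hk⟩ := F.covers k
  have hsum : Summable fun j => |(f j).toSeq k| := by
    refine summable_of_sum_le (c := C) (fun j => abs_nonneg _) fun s => ?_
    have h := hC s (fun j => SignType.sign ((f j).toSeq k)) fun j => by
      rcases lt_trichotomy ((f j).toSeq k) 0 with h | h | h <;> simp [h]
    refine le_trans ?_ ((X.sum_abs_le_norm _ hE).trans h)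
    refine le_trans ?_ (Finset.single_le_sum (fun _ _ => abs_nonneg _) hk)
    rw [X.toSeq_sum]
    refine le_trans (le_of_eq (Finset.sum_congr rfl fun j _ => ?_)) (le_abs_self _)
    rw [X.toSeq_smul, Pi.smul_apply, smul_eq_mul, sign_mul_self]
  exact (tendsto_zero_iff_abs_tendsto_zero _).2 hsum.tendsto_atTop_zero

/-- The sliding hump argument. -/
theorem exists_hasBumps_of_norm_sum_smul_le {F : FHC} {f : ℕ → F.X} {c C : ℝ} (hc : 0 < c)
    (hf : ∀ j, c ≤ ‖f j‖)
    (hC : ∀ (s : Finset ℕ) (σ : ℕ → ℝ), (∀ j, |σ j| ≤ 1) → ‖∑ j ∈ s, σ j • f j‖ ≤ C) :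
    ∃ y, F.HasBumps y := by
  have hump : ∀ i n : ℕ, ∃ m, n < m ∧ ∃ j, n ≤ j ∧ j < m ∧ ∀ E ∈ F.family,
      ∑ k ∈ E with ¬ (n ≤ k ∧ k < m), |(f j).toSeq k| ≤ c / 4 * (1 / 2) ^ i := by
    intro i n
    set ε := c / 4 * (1 / 2) ^ i with hε
    have hε0 : 0 < ε := by positivity
    have h1 : Tendsto (fun j => ∑ k ∈ Finset.range n, |(f j).toSeq k|) atTop (𝓝 0) := by
      have := tendsto_finsetSum (Finset.range n) fun k _ =>
        (tendsto_toSeq_of_norm_sum_smul_le hC k).abs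
      simpa using this
    obtain ⟨j, hj, hnj⟩ :=
      ((h1.eventually (gt_mem_nhds (half_pos hε0))).and (eventually_ge_atTop n)).exists
    have h2 : Tendsto (fun m : ℕ => F.extNorm ((Ici m).indicator (f j).toSeq)) atTop (𝓝 0) :=
      (f j).2
    obtain ⟨m, hm, hjm⟩ := ((ENNReal.tendsto_nhds_zero.1 h2 (ENNReal.ofReal (ε / 2))
      (ENNReal.ofReal_pos.2 (half_pos hε0))).and (eventually_gt_atTop j)).exists
    rw [extNorm_le_iff F _ (half_pos hε0).le] at hm
    refine ⟨m, hnj.trans_lt hjm, j, hnj, hjm, fun E hE => ?_⟩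
    calc ∑ k ∈ E with ¬ (n ≤ k ∧ k < m), |(f j).toSeq k|
        ≤ ∑ k ∈ E, ((if k < n then |(f j).toSeq k| else 0) +
            |(Ici m).indicator (f j).toSeq k|) := by
          rw [Finset.sum_filter]
          refine Finset.sum_le_sum fun k _ => ?_
          by_cases h1 : k < n
          · simp [h1, not_le.2 h1]
          · by_cases h2 : m ≤ k
            · simp [h1, Set.indicator, h2]
            · simp [h1, not_lt.1 h1, not_le.1 h2]
      _ ≤ ∑ k ∈ Finset.range n, |(f j).toSeq k| + ε / 2 := by
          rw [Finset.sum_add_distrib, ← Finset.sum_filter]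
          refine add_le_add (Finset.sum_le_sum_of_subset_of_nonneg (fun k hk => ?_)
            fun _ _ _ => abs_nonneg _) (hm E hE)
          exact Finset.mem_range.2 (Finset.mem_filter.1 hk).2
      _ ≤ ε := by linarith
  obtain ⟨u, b, hu, hP, hb⟩ := exists_strictMono_blocks hump
  choose j hj1 hj2 hj using hP
  have hjb : ∀ i, ∀ E ∈ F.family,
      ∑ k ∈ E with b k ≠ i, |(f (j i)).toSeq k| ≤ c / 4 * (1 / 2) ^ i := fun i E hE => by
    simpa only [ne_eq, hb] using hj i E hE
  have hjmono : StrictMono j := strictMono_nat_of_lt_succ fun i => (hj2 i).trans_le (hj1 (i + 1))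
  have hCn : 0 ≤ C := (norm_nonneg _).trans (hC ∅ 0 (by simp))
  refine ⟨fun k => (f (j (b k))).toSeq k, ?_, c / 2, half_pos hc, fun n => ?_⟩
  · refine ne_top_of_le_ne_top ENNReal.ofReal_ne_top
      ((extNorm_le_iff F _ (M := C + c / 2) (by positivity)).2 fun E hE => ?_)
    obtain ⟨N, hN⟩ : ∃ N, ∀ k ∈ E, b k ∈ Finset.range N :=
      ⟨E.sup b + 1, fun k hk => Finset.mem_range.2 (Nat.lt_succ_of_le (Finset.le_sup hk))⟩
    have hpt : ∀ k ∈ E, |(f (j (b k))).toSeq k| ≤ |∑ i ∈ Finset.range N, (f (j i)).toSeq k| +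
        ∑ i ∈ Finset.range N, if b k ≠ i then |(f (j i)).toSeq k| else 0 := fun k hk => by
      rw [← Finset.sum_filter, Finset.filter_ne, ← Finset.add_sum_erase _ _ (hN k hk)]
      have h1 := Finset.abs_sum_le_sum_abs (fun i => (f (j i)).toSeq k)
        ((Finset.range N).erase (b k))
      have h2 := abs_sub_abs_le_abs_add ((f (j (b k))).toSeq k)
        (∑ i ∈ (Finset.range N).erase (b k), (f (j i)).toSeq k)
      linarith
    have hsum : ∑ k ∈ E, |∑ i ∈ Finset.range N, (f (j i)).toSeq k| ≤ C := by
      have h := hC ((Finset.range N).map ⟨j, hjmono.injective⟩) 1 (by simp)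
      have h' := (X.sum_abs_le_norm _ hE).trans h
      simpa [X.toSeq_sum] using h'
    calc ∑ k ∈ E, |(f (j (b k))).toSeq k|
        ≤ ∑ k ∈ E, |∑ i ∈ Finset.range N, (f (j i)).toSeq k| +
          ∑ k ∈ E, ∑ i ∈ Finset.range N, (if b k ≠ i then |(f (j i)).toSeq k| else 0) := by
          rw [← Finset.sum_add_distrib]
          exact Finset.sum_le_sum hpt
      _ ≤ C + ∑ i ∈ Finset.range N, c / 4 * (1 / 2) ^ i := by
          rw [Finset.sum_comm]
          refine add_le_add hsum (Finset.sum_le_sum fun i _ => ?_)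
          rw [← Finset.sum_filter]
          exact hjb i E hE
      _ ≤ C + c / 2 := by
          rw [← Finset.mul_sum]
          have := mul_le_mul_of_nonneg_left (sum_geometric_two_le N) (by positivity : 0 ≤ c / 4)
          linarith
  · obtain ⟨E, hE, hEc⟩ : ∃ E ∈ F.family, 3 * c / 4 < ∑ k ∈ E, |(f (j n)).toSeq k| := by
      by_contra! h
      have := (hf (j n)).trans ((X.norm_le_iff _ (by positivity)).2 h)
      linarith
    refine ⟨E.filter (b · = n), F.hereditary E hE _ (Finset.filter_subset _ _), fun k hk => ?_, ?_⟩
    · exact (hu.id_le n).trans ((hb k n).1 (Finset.mem_filter.1 hk).2).1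
    · have h1 : ∑ k ∈ E with b k = n, |(f (j (b k))).toSeq k| =
          ∑ k ∈ E with b k = n, |(f (j n)).toSeq k| :=
        Finset.sum_congr rfl fun k hk => by rw [(Finset.mem_filter.1 hk).2]
      have h2 := Finset.sum_filter_add_sum_filter_not E (b · = n) fun k => |(f (j n)).toSeq k|
      have h3 := hjb n E hE
      have h4 : c / 4 * (1 / 2) ^ n ≤ c / 4 :=
        mul_le_of_le_one_right (by positivity) (pow_le_one₀ (by norm_num) (by norm_num))
      rw [h1]
      simp only [ne_eq] at h3
      linarith

theorem exists_hasBumps_of_containsC0 {F : FHC} (h : ContainsC0 F.X) : ∃ y, F.HasBumps y := by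
  obtain ⟨T, c, C, hc, hT, hT'⟩ := h.exists_bounds
  have hCn : 0 ≤ C := by
    have h1 := (mul_nonneg hc.le (norm_nonneg (c0Single 0))).trans
      ((hT' _).trans (hT (c0Single 0)))
    exact nonneg_of_mul_nonneg_left h1 (one_pos.trans_le (one_le_norm_c0Single 0))
  refine exists_hasBumps_of_norm_sum_smul_le (f := fun j => T (c0Single j)) (C := C) hc
    (fun j => ?_) fun s σ hσ => ?_
  · exact (le_mul_of_one_le_right hc.le (one_le_norm_c0Single j)).trans (hT' _)
  · have : ∑ j ∈ s, σ j • T (c0Single j) = T (∑ j ∈ s, σ j • c0Single j) := by simp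
    rw [this]
    exact (hT _).trans (mul_le_of_le_one_right hCn (norm_sum_smul_c0Single_le s σ hσ))

end FHC

/-! ### Large subsets of the Cantor space -/

/-- The part `∑ k ∈ D, |y k|` of the sum that is selected by `χ` is at least `r`. -/
def heavySet (y : ℕ → ℝ) (r : ℝ) (D : Finset ℕ) : Set (ℕ → Bool) :=
  {χ | r ≤ ∑ k ∈ D, if χ k = true then |y k| else 0}

instance : IsProbabilityMeasure cantorMeasure :=
  inferInstanceAs (IsProbabilityMeasure (Measure.infinitePi _))

theorem map_not_cantorMeasure :
    cantorMeasure.map (fun χ n => !(χ n)) = cantorMeasure := by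
  unfold cantorMeasure
  rw [Measure.infinitePi_map_pi (f := fun _ => Bool.not) _ fun _ => measurable_of_finite _]
  congr 1
  funext _
  refine Measure.ext_of_singleton fun b => ?_
  rw [Measure.map_apply (measurable_of_finite _) (measurableSet_singleton b)]
  cases b
  · rw [show Bool.not ⁻¹' {false} = {true} by ext c; cases c <;> simp]
    simp
  · rw [show Bool.not ⁻¹' {true} = {false} by ext c; cases c <;> simp]
    simp

theorem isOpen_heavySet (y : ℕ → ℝ) (r : ℝ) (D : Finset ℕ) : IsOpen (heavySet y r D) := by
  have h : heavySet y r D =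
      D.restrict ⁻¹' {c : D → Bool | r ≤ ∑ k : D, if c k = true then |y k| else 0} := by
    ext χ
    simp only [heavySet, mem_ofPred_eq, mem_preimage, Finset.restrict]
    rw [← Finset.sum_coe_sort D fun k => if χ k = true then |y k| else 0]
    rfl
  rw [h]
  exact (isOpen_discrete _).preimage (continuous_pi fun k => continuous_apply _)

variable {y : ℕ → ℝ} {δ : ℝ} {D : ℕ → Finset ℕ}

theorem measurableSet_limsup_heavySet (y : ℕ → ℝ) (r : ℝ) {D : ℕ → Finset ℕ}
    (hD : ∀ n, ∀ k ∈ D n, n ≤ k) :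
    MeasurableSet[limsup (fun k => MeasurableSpace.comap (fun χ : ℕ → Bool => χ k) ⊤) atTop]
      {χ | ∃ᶠ n in atTop, χ ∈ heavySet y r (D n)} := by
  rw [limsup_eq_iInf_iSup_of_nat, MeasurableSpace.measurableSet_iInf]
  intro N
  have : {χ : ℕ → Bool | ∃ᶠ n in atTop, χ ∈ heavySet y r (D n)} =
      ⋂ M : ℕ, ⋃ n : ℕ, ⋃ (_ : M ≤ n ∧ N ≤ n), heavySet y r (D n) := by
    ext χ
    simp only [mem_ofPred_eq, mem_iInter, mem_iUnion, frequently_atTop]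
    constructor
    · intro h M
      obtain ⟨n, hn, hx⟩ := h (max M N)
      exact ⟨n, ⟨le_of_max_le_left hn, le_of_max_le_right hn⟩, hx⟩
    · intro h M
      obtain ⟨n, hn, hx⟩ := h M
      exact ⟨n, hn.1, hx⟩
  rw [this]
  refine MeasurableSet.iInter fun M => MeasurableSet.iUnion fun n => MeasurableSet.iUnion fun hn => ?_
  let m : MeasurableSpace (ℕ → Bool) :=
    ⨆ i, ⨆ (_ : i ≥ N), MeasurableSpace.comap (fun χ : ℕ → Bool => χ i) ⊤
  have hk : ∀ k ∈ D n, Measurable[m] fun χ : ℕ → Bool => if χ k = true then |y k| else 0 := by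
    intro k hk
    have h1 : Measurable[m] fun χ : ℕ → Bool => χ k := by
      rw [measurable_iff_comap_le]
      exact le_iSup₂_of_le k (hn.2.trans (hD n k hk)) le_rfl
    exact (measurable_of_finite fun b : Bool => if b = true then |y k| else 0).comp h1
  exact measurableSet_le measurable_const (Finset.measurable_fun_sum _ hk)

theorem cantorMeasure_limsup_heavySet (hδ : ∀ n, δ ≤ ∑ k ∈ D n, |y k|)
    (hD : ∀ n, ∀ k ∈ D n, n ≤ k) :
    cantorMeasure {χ | ∃ᶠ n in atTop, χ ∈ heavySet y (δ / 2) (D n)}ᶜ = 0 := by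
  set S := {χ | ∃ᶠ n in atTop, χ ∈ heavySet y (δ / 2) (D n)} with hS
  have hind : ProbabilityTheory.iIndep
      (fun k => MeasurableSpace.comap (fun χ : ℕ → Bool => χ k) ⊤) cantorMeasure :=
    ProbabilityTheory.iIndepFun_infinitePi (X := fun _ b => b) fun _ => measurable_id
  have hle : ∀ k, MeasurableSpace.comap (fun χ : ℕ → Bool => χ k) ⊤ ≤ MeasurableSpace.pi :=
    fun k => (measurable_pi_apply k).comap_le
  have htail := measurableSet_limsup_heavySet y (δ / 2) hD
  have hmeas : MeasurableSet S := (limsup_le_iSup.trans (iSup_le hle)) _ htail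
  rw [prob_compl_eq_zero_iff hmeas]
  refine (ProbabilityTheory.measure_zero_or_one_of_measurableSet_limsup_atTop hle hind
    htail).resolve_left fun h0 => ?_
  have hcov : S ∪ (fun χ n => !(χ n)) ⁻¹' S = univ := by
    refine eq_univ_of_forall fun χ => ?_
    simp only [hS, mem_union, mem_preimage, mem_ofPred_eq, ← frequently_or_distrib]
    refine Frequently.of_forall fun n => ?_
    simp only [heavySet, mem_ofPred_eq]
    by_contra! h
    have h1 := add_lt_add h.1 h.2
    rw [← Finset.sum_add_distrib] at h1
    refine absurd (h1.trans_le' (le_of_eq (Finset.sum_congr rfl fun k _ => ?_)))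
      (not_lt.2 ((add_halves δ).le.trans (hδ n)))
    by_cases hk : χ k = true <;> simp [hk]
  have h1 : cantorMeasure ((fun χ n => !(χ n)) ⁻¹' S) = 0 := by
    have hflip : Measurable fun (χ : ℕ → Bool) n => !(χ n) := measurable_pi_lambda _ fun n =>
      (measurable_of_finite Bool.not).comp (measurable_pi_apply n)
    rw [← Measure.map_apply hflip hmeas, map_not_cantorMeasure, h0]
  have := measure_union_le (μ := cantorMeasure) S ((fun χ n => !(χ n)) ⁻¹' S)
  rw [hcov, measure_univ, h0, h1] at this
  simp at this

theorem limsup_heavySet_mem_residual {r : ℝ} (hδ : ∀ n, r ≤ ∑ k ∈ D n, |y k|)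
    (hD : ∀ n, ∀ k ∈ D n, n ≤ k) :
    {χ | ∃ᶠ n in atTop, χ ∈ heavySet y r (D n)} ∈ residual (ℕ → Bool) := by
  have : {χ : ℕ → Bool | ∃ᶠ n in atTop, χ ∈ heavySet y r (D n)} =
      ⋂ M : ℕ, ⋃ n : ℕ, ⋃ (_ : M ≤ n), heavySet y r (D n) := by
    ext χ
    simp [frequently_atTop]
  rw [this, countable_iInter_mem]
  intro M
  refine residual_of_dense_open
    (isOpen_iUnion fun n => isOpen_iUnion fun _ => isOpen_heavySet _ _ _) fun χ => ?_
  let ψ : ℕ → ℕ → Bool := fun n k => if k ∈ D n then true else χ k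
  have hψ : Tendsto ψ atTop (𝓝 χ) := by
    refine tendsto_pi_nhds.2 fun k => tendsto_const_nhds.congr' ?_
    filter_upwards [eventually_gt_atTop k] with n hn
    exact (if_neg fun h => absurd (hD n k h) (not_le.2 hn)).symm
  refine mem_closure_of_tendsto hψ ?_
  filter_upwards [eventually_ge_atTop M] with n hn
  refine mem_iUnion₂.2 ⟨n, hn, (hδ n).trans (le_of_eq (Finset.sum_congr rfl fun k hk => ?_))⟩
  simp [ψ, hk]

theorem FHC.HasBumps.exists_heavySet_subset {F : FHC} {y : ℕ → ℝ} (hy : F.HasBumps y) :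
    ∃ (δ : ℝ) (D : ℕ → Finset ℕ), 0 < δ ∧ (∀ n, ∀ k ∈ D n, n ≤ k) ∧
      (∀ n, δ ≤ ∑ k ∈ D n, |y k|) ∧
      toCantor F.notC0 ⊆ {χ | ∃ᶠ n in atTop, χ ∈ heavySet y (δ / 2) (D n)}ᶜ := by
  obtain ⟨hfin, δ, hδ, hD⟩ := hy
  choose D hDF hDn hDs using hD
  refine ⟨δ, D, hδ, hDn, hDs, fun χ hχ hfr => hχ ?_⟩
  classical
  refine HasBumps.containsC0 (y := {n | χ n = true}.indicator y)
    ⟨ne_top_of_le_ne_top hfin (F.extNorm_mono fun k => ?_), δ / 2, half_pos hδ, fun n => ?_⟩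
    fun k hk => indicator_of_notMem hk y
  · by_cases hk : χ k = true <;> simp [Set.indicator, hk]
  · obtain ⟨m, hm, hs⟩ := frequently_atTop.1 hfr n
    refine ⟨D m, hDF m, fun k hk => hm.trans (hDn m k hk), hs.trans (le_of_eq ?_)⟩
    refine Finset.sum_congr rfl fun k _ => ?_
    by_cases hk : χ k = true <;> simp [Set.indicator, hk]

theorem mainTheorem9 (F : FHC) :
    List.TFAE
      [¬ ContainsC0 F.X,
        F.notC0 = Set.univ,
        ¬ cantorMeasure (toCantor F.notC0) = 0,
        ¬ IsMeagre (toCantor F.notC0)] := by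
  have huniv : F.notC0 = Set.univ → toCantor F.notC0 = Set.univ := fun h => by
    rw [h]
    rfl
  tfae_have 1 → 2 := fun h => eq_univ_of_forall fun H hH => h hH.of_submodule
  tfae_have 2 → 3 := fun h => by
    rw [huniv h, measure_univ]
    exact one_ne_zero
  tfae_have 2 → 4 := fun h => by
    rw [huniv h]
    exact not_isMeagre_of_isOpen isOpen_univ univ_nonempty
  tfae_have 3 → 1 := fun h hc => by
    obtain ⟨y, hy⟩ := FHC.exists_hasBumps_of_containsC0 hc
    obtain ⟨δ, D, _, hD, hs, hsub⟩ := hy.exists_heavySet_subset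
    exact h (measure_mono_null hsub (cantorMeasure_limsup_heavySet hs hD))
  tfae_have 4 → 1 := fun h hc => by
    obtain ⟨y, hy⟩ := FHC.exists_hasBumps_of_containsC0 hc
    obtain ⟨δ, D, hδ, hD, hs, hsub⟩ := hy.exists_heavySet_subset
    refine h (IsMeagre.mono hsub ?_)
    rw [IsMeagre, compl_compl]
    exact limsup_heavySet_mem_residual (fun n => (half_le_self hδ.le).trans (hs n)) hD
  tfae_finish
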